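/- **Setting.** Let $\mathcal N=(\mathcal G,S,\rho)$ be a network: $\mathcal G=(\mathcal V,\mathcal E)$ is a finite directed acyclic multigraph, $S=\{\sigma_1,\dots,\sigma_s\}\subset\mathcal V$ ($s\ge 1$) is a set of distinct source nodes without input edges, $\rho\in\mathcal V\setminus S$ is a sink without output edges, and every node other than $\rho$ has a directed path to $\rho$. Let $q$ be a prime power, $T\in\mathbb F_q^{s\times k}$ a matrix without zero rows, and $r\ge 0$ an integer. Each source $\sigma_i$ generates $\ell$ symbols $\mathbf M_i\in\mathbb F_q^\ell$ and has a key $\mathbf K_i$ from a finite nonempty alphabet; all source symbols and keys are independent and uniformly distributed. An $(\ell,n)$ code ($\ell,n\ge1$) assigns to each edge $e$ a message $Y_e\in\mathbb F_q^n$, which is a function of $(\mathbf M_i,\mathbf K_i)$ if $e$ leaves $\sigma_i$, and a function of the messages on the input edges of the tail of $e$ otherwise, and it has a decoding function at $\rho$. It is admissible if $\rho$ always recovers, from the messages on its input edges, the $\ell$ values of $\vec m\mapsto\vec m\,T$, and if for all $W\subseteq\mathcal E$ with $|W|\le r$ the messages $(Y_e)_{e\in W}$ are independent of $(\mathbf M_1,\dots,\mathbf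 M_s)$. A rate $R\ge0$ is achievable if for each $\epsilon>0$ there is an admissible $(\ell,n)$ code with $\ell/n>R-\epsilon$. The capacity $\hat{\mathcal C}(\mathcal N,T,r)$ is the maximum of the set of achievable rates (and $0$ if there is no admissible code). **Cuts.** A set of edges $C$ is a cut separating $Y$ from $X$ if after deleting $C$ there is no path from an element of $X$ to an element of $Y$, where elements may be nodes or edges, and a path from or to an edge contains that edge. A minimum cut is a cut with the fewest edges. For $C\subseteq\mathcal E$ let $D_C$ be the set of sources with a path to some edge in $C$, let $I_C$ be the set of sources with no path to $\rho$ after deleting $C$, and let $\Lambda(\mathcal N)=\{C\subseteq\mathcal E: I_C\ne\emptyset\}$. For $A\subseteq S$, $T_A$ is the submatrix of the rows of $T$ indexed by $A$. * $\mathcal W_r^*$ is the set of all $W\subseteq\mathcal E$ with $|W|\le r$ such that $|W|$ is the size of a minimum cut separating $W$ from $D_W$. Write $\alpha\sim^s\beta$ if some edge set is both a minimum cut separating $\alpha$ from $D_\alpha$ and a minimum cut separating $\beta$ from $D_\beta$. Write $\alpha\le\beta$ if $\alpha$ is a minimum cut separating $\beta$ from $D_\beta$. $\widehat{\mathcal W}_r^*$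 is the set of bottom (least) elements, for $\le$, of the classes of $\mathcal W_r^*$ under $\sim^s$. * For $W\subseteq\mathcal E$ let $\mathcal G_W$ be $\mathcal G$ with the edges in $W$ deleted. For $C\subseteq\mathcal E\setminus W$ let $I_C^W$ be the set of sources with no path to $\rho$ in $\mathcal G_W$ after deleting $C$. $\mathcal C_W^*$ is the set of all $C\subseteq\mathcal E\setminus W$ with $I_C^W\neq\emptyset$ and $D_W\subseteq I_C^W$ such that $|C|$ is the size of a minimum cut separating $\rho$ from $C$ in $\mathcal G_W$. Write $\alpha\sim^\rho\beta$ if some edge set is a minimum cut in $\mathcal G_W$ separating $\rho$ from $\alpha$ and also one separating $\rho$ from $\beta$. Write $\alpha\le^\rho\beta$ if $\beta$ is a minimum cut in $\mathcal G_W$ separating $\rho$ from $\alpha$. $\widehat{\mathcal C}_W^*$ is the set of top (greatest) elements, for $\le^\rho$, of the classes of $\mathcal C_W^*$ under $\sim^\rho$. **Theorem.** Each class of $\mathcal W_r^*$ under $\sim^s$ has exactly one bottom element, and for $W\in\widehat{\mathcal W}_r^*$ each class of $\mathcal C_W^*$ under $\sim^\rho$ has exactly one top element. If the set of achievable rates is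 nonempty, it has a maximum. Moreover $$\hat{\mathcal C}(\mathcal N,T,r)\;\le\;\min_{\substack{W\subseteq C\subseteq\mathcal E,\ |W|\le r,\\ C\in\Lambda(\mathcal N),\ D_W\subseteq I_C}}\frac{|C|-|W|}{\operatorname{Rank}(T_{I_C})}\;=\;\min_{W\in\widehat{\mathcal W}_r^*}\ \min_{C\in\widehat{\mathcal C}_W^*}\frac{|C|}{\operatorname{Rank}(T_{I_C^W})},$$ where all minima are taken over nonempty sets. -/

import Mathlib

open scoped Classical

noncomputable section

/-! ### Networks -/

/-- A single-sink network: a directed acyclic multigraph with node set `V` and edge set `E`,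
`s` distinct source nodes without input edges, and a sink node without output edges that can be
reached from every other node. `EdgePath` below is the same notion of path that the two
last fields use: `Relation.ReflTransGen` chains consecutive edges. -/
structure Network (V E : Type*) (s : ℕ) where
  tail : E → V
  head : E → V
  source : Fin s → V
  sink : V
  source_injective : Function.Injective source
  source_ne_sink : ∀ i, source i ≠ sink
  source_no_input : ∀ i e, head e ≠ source i
  sink_no_output : ∀ e, tail e ≠ sink
  acyclic : ∀ d e, Relation.ReflTransGen (fun a b => head a = tail b) d e → head e ≠ tail d
  reach_sink : ∀ u, u ≠ sink →
    ∃ d e, tail d = u ∧ Relation.ReflTransGen (fun a b => head a = tail b) d e ∧ head e = sink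

namespace Network

variable {V E : Type*} {s : ℕ} (N : Network V E s)

/-- There is a path with first edge `d` and last edge `e` after deleting the edges in `X`
(so none of the edges of the path, `d` and `e` included, is in `X`). -/
def EdgePath (X : Finset E) (d e : E) : Prop :=
  d ∉ X ∧ Relation.ReflTransGen (fun a b => N.head a = N.tail b ∧ b ∉ X) d e

/-- There is a path from the node `u` to the edge `e` after deleting the edges in `X`. -/
def NodeEdgePath (X : Finset E) (u : V) (e : E) : Prop :=
  ∃ d, N.tail d = u ∧ N.EdgePath X d e

/-- There is a path from the edge `d` to the node `v` after deleting the edges in `X`. -/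
def EdgeNodePath (X : Finset E) (d : E) (v : V) : Prop :=
  ∃ e, N.EdgePath X d e ∧ N.head e = v

/-- There is a path from the node `u` to the node `v` after deleting the edges in `X`. -/
def NodePath (X : Finset E) (u v : V) : Prop :=
  ∃ d e, N.tail d = u ∧ N.EdgePath X d e ∧ N.head e = v

/-- `D_C`: the (indices of) sources from which some edge of `C` can be reached. -/
def D (C : Finset E) : Finset (Fin s) :=
  Finset.univ.filter fun i => ∃ e ∈ C, N.NodeEdgePath ∅ (N.source i) e

/-- `I_C`: the (indices of) sources that are cut off from the sink by deleting `C`. -/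
def I (C : Finset E) : Finset (Fin s) :=
  Finset.univ.filter fun i => ¬ N.NodePath C (N.source i) N.sink

/-- `Λ(N)`: the cut sets of the network. -/
def cutSets : Set (Finset E) := {C | (N.I C).Nonempty}

/-! ### Cuts between the sources and an edge subset -/

/-- `C` separates the edge subset `A` from the set `U` of sources. -/
def IsCutFromSources (U : Finset (Fin s)) (A C : Finset E) : Prop :=
  ∀ i ∈ U, ∀ e ∈ A, ¬ N.NodeEdgePath C (N.source i) e

/-- `mincut(U, A)`; the set is never empty, since `A` separates itself from `U`. -/
def mincutFromSources (U : Finset (Fin s)) (A : Finset E) : ℕ :=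
  sInf {c | ∃ C : Finset E, N.IsCutFromSources U A C ∧ C.card = c}

/-- `MINCUT(U, A)`. -/
def MINCUTFromSources (U : Finset (Fin s)) (A : Finset E) : Set (Finset E) :=
  {C | N.IsCutFromSources U A C ∧ ∀ C', N.IsCutFromSources U A C' → C.card ≤ C'.card}

/-- `W_r^*`. -/
def wiretapStar (r : ℕ) : Set (Finset E) :=
  {W | W.card = N.mincutFromSources (N.D W) W ∧ W.card ≤ r}

/-- `α ~ˢ β`: a common minimum cut separates `α` from `D_α` and `β` from `D_β`. -/
def SourceEquiv (α β : Finset E) : Prop :=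
  ∃ ξ, ξ ∈ N.MINCUTFromSources (N.D α) α ∧ ξ ∈ N.MINCUTFromSources (N.D β) β

/-- `α ≤ β`: `α` is a minimum cut separating `β` from `D_β`. -/
def SourceLE (α β : Finset E) : Prop := α ∈ N.MINCUTFromSources (N.D β) β

/-- The classes of `W_r^*` under `~ˢ`. -/
def sourceClasses (r : ℕ) : Set (Set (Finset E)) :=
  {Cl | ∃ α ∈ N.wiretapStar r, Cl = {β | β ∈ N.wiretapStar r ∧ N.SourceEquiv α β}}

/-- `b` is a bottom element of the class `Cl`. -/
def IsBottomOf (Cl : Set (Finset E)) (b : Finset E) : Prop :=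
  b ∈ Cl ∧ ∀ β ∈ Cl, N.SourceLE b β

/-- The set of bottom elements of all classes of `W_r^*`. -/
def wiretapHat (r : ℕ) : Set (Finset E) :=
  {b | ∃ Cl ∈ N.sourceClasses r, N.IsBottomOf Cl b}

/-! ### Cuts between an edge subset and the sink in the residual graph `G_W`

The edges of `G_W` are the edges outside `W`, so edge subsets of `G_W` are the finite sets
disjoint from `W`, and deleting `C` from `G_W` is deleting `W ∪ C` from the whole graph. -/

/-- `I^W_C`: the sources that are cut off from the sink in `G_W` by deleting `C`. -/
def IRes (W C : Finset E) : Finset (Fin s) :=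
  Finset.univ.filter fun i => ¬ N.NodePath (W ∪ C) (N.source i) N.sink

/-- `Λ(N_W)`. -/
def cutSetsRes (W : Finset E) : Set (Finset E) :=
  {C | Disjoint C W ∧ (N.IRes W C).Nonempty}

/-- `C` is an edge subset of `G_W` that separates the sink from `A` in `G_W`. -/
def IsCutToSink (W A C : Finset E) : Prop :=
  Disjoint C W ∧ ∀ e ∈ A, ¬ N.EdgeNodePath (W ∪ C) e N.sink

/-- `mincut^W(A, ρ)`, used for edge subsets `A` of `G_W`; then `A` separates the sink from
itself, and the set is not empty. -/
def mincutToSink (W A : Finset E) : ℕ :=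
  sInf {c | ∃ C : Finset E, N.IsCutToSink W A C ∧ C.card = c}

/-- `MINCUT^W(A, ρ)`. -/
def MINCUTToSink (W A : Finset E) : Set (Finset E) :=
  {C | N.IsCutToSink W A C ∧ ∀ C', N.IsCutToSink W A C' → C.card ≤ C'.card}

/-- `C_W^*`. -/
def cutStar (W : Finset E) : Set (Finset E) :=
  {C | C ∈ N.cutSetsRes W ∧ C.card = N.mincutToSink W C ∧ N.D W ⊆ N.IRes W C}

/-- `α ~^ρ β` in `G_W`: a common minimum cut separates the sink from `α` and from `β`. -/
def SinkEquiv (W α β : Finset E) : Prop :=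
  ∃ ξ, ξ ∈ N.MINCUTToSink W α ∧ ξ ∈ N.MINCUTToSink W β

/-- `α ≤^ρ β` in `G_W`: `β` is a minimum cut separating the sink from `α`. -/
def SinkLE (W α β : Finset E) : Prop := β ∈ N.MINCUTToSink W α

/-- The classes of `C_W^*` under `~^ρ`. -/
def sinkClasses (W : Finset E) : Set (Set (Finset E)) :=
  {Cl | ∃ α ∈ N.cutStar W, Cl = {β | β ∈ N.cutStar W ∧ N.SinkEquiv W α β}}

/-- `t` is a top element of the class `Cl`. -/
def IsTopOf (W : Finset E) (Cl : Set (Finset E)) (t : Finset E) : Prop :=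
  t ∈ Cl ∧ ∀ β ∈ Cl, N.SinkLE W β t

/-- The set of top elements of all classes of `C_W^*`. -/
def cutHat (W : Finset E) : Set (Finset E) :=
  {t | ∃ Cl ∈ N.sinkClasses W, N.IsTopOf W Cl t}

/-! ### Secure network codes -/

theorem wellFounded_edges [Finite E] : WellFounded fun d e => N.head d = N.tail e := by
  let R : E → E → Prop := fun d e => N.head d = N.tail e
  have : Std.Irrefl (Relation.TransGen R) := ⟨fun e h => by
    obtain ⟨d, hd, hde⟩ := Relation.TransGen.tail'_iff.mp h
    exact N.acyclic e d hd hde⟩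
  have hwf : WellFounded (Relation.TransGen R) := Finite.wellFounded_of_trans_of_irrefl _
  have hsub : Subrelation R (Relation.TransGen R) := fun h => Relation.TransGen.single h
  exact hsub.wf hwf

/-- An `(ℓ, n)` function-computing secure network code: a finite nonempty key alphabet at each
source, the local encoding functions of the edges that leave a source, those of the other
edges, and the decoding function at the sink. -/
structure Code (A B O : Type*) (ℓ n : ℕ) where
  Key : Fin s → Type
  keyFinite : ∀ i, Finite (Key i)
  keyNonempty : ∀ i, Nonempty (Key i)
  encSource : ∀ (i : Fin s), {e : E // N.tail e = N.source i} →
    (Fin ℓ → A) → Key i → (Fin n → B)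
  encRelay : ∀ e : {e : E // ¬ ∃ i, N.tail e = N.source i},
    ({d : E // N.head d = N.tail e.1} → Fin n → B) → (Fin n → B)
  dec : ({d : E // N.head d = N.sink} → Fin n → B) → (Fin ℓ → O)

namespace Code

variable {N} {A B O : Type*} {ℓ n : ℕ} [Finite E] (c : N.Code A B O ℓ n)

/-- The global encoding function of an edge: the message transmitted on `e` when the source
messages are `m` and the keys are `κ`. -/
def globalEnc (m : Fin s → Fin ℓ → A) (κ : ∀ i, c.Key i) : E → Fin n → B :=
  N.wellFounded_edges.fix fun e rec =>
    if h : ∃ i, N.tail e = N.source i then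
      c.encSource h.choose ⟨e, h.choose_spec⟩ (m h.choose) (κ h.choose)
    else c.encRelay ⟨e, h⟩ fun d => rec d.1 d.2

theorem globalEnc_source (m : Fin s → Fin ℓ → A) (κ : ∀ i, c.Key i) (i : Fin s) (e : E)
    (h : N.tail e = N.source i) :
    c.globalEnc m κ e = c.encSource i ⟨e, h⟩ (m i) (κ i) := by
  have h' : ∃ i, N.tail e = N.source i := ⟨i, h⟩
  rw [globalEnc, WellFounded.fix_eq, dif_pos h']
  have key : ∀ (j : Fin s) (hj : N.tail e = N.source j),
      c.encSource j ⟨e, hj⟩ (m j) (κ j) = c.encSource i ⟨e, h⟩ (m i) (κ i) := by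
    intro j hj
    obtain rfl : j = i := N.source_injective (hj.symm.trans h)
    rfl
  exact key _ _

theorem globalEnc_relay (m : Fin s → Fin ℓ → A) (κ : ∀ i, c.Key i) (e : E)
    (h : ¬ ∃ i, N.tail e = N.source i) :
    c.globalEnc m κ e = c.encRelay ⟨e, h⟩ fun d => c.globalEnc m κ d.1 := by
  rw [globalEnc, WellFounded.fix_eq, dif_neg h]

/-- The sink computes `f` with zero error. -/
def Computes (f : (Fin s → A) → O) : Prop :=
  ∀ (m : Fin s → Fin ℓ → A) (κ : ∀ i, c.Key i),
    c.dec (fun d => c.globalEnc m κ d.1) = fun j => f fun i => m i j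

/-- For each wiretap set `W` of size at most `r`, the messages on the edges of `W` are
stochastically independent of the `ℓ` values of `ζ`. All source symbols and all keys are
independent and uniformly distributed, so that the sample space is the set of all pairs
of a message vector and a key vector, with the uniform distribution. -/
def Secure {Q : Type*} (ζ : (Fin s → A) → Q) (r : ℕ) : Prop :=
  ∀ W : Finset E, W.card ≤ r →
    @ProbabilityTheory.IndepFun ((Fin s → Fin ℓ → A) × (∀ i, c.Key i))
      (W → Fin n → B) (Fin ℓ → Q) ⊤ ⊤ ⊤
      (fun ω e => c.globalEnc ω.1 ω.2 e.1)
      (fun ω j => ζ fun i => ω.1 i j)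
      (@ProbabilityTheory.uniformOn _ ⊤ Set.univ)

end Code

/-- The secure computing rate region: the achievable rates for target function `f`, security
function `ζ`, security level `r`, and edges that carry one symbol of `B` per use. -/
def rateRegion [Finite E] {A O Q : Type*} (B : Type*) (f : (Fin s → A) → O)
    (ζ : (Fin s → A) → Q) (r : ℕ) : Set ℝ :=
  {R | 0 ≤ R ∧ ∀ ε : ℝ, 0 < ε → ∃ (ℓ n : ℕ) (c : N.Code A B O ℓ n),
    0 < ℓ ∧ 0 < n ∧ c.Computes f ∧ c.Secure ζ r ∧ R - ε < (ℓ : ℝ) / n}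

/-- The secure computing capacity (`0` if there is no admissible code at all). -/
def secureCapacity [Finite E] {A O Q : Type*} (B : Type*) (f : (Fin s → A) → O)
    (ζ : (Fin s → A) → Q) (r : ℕ) : ℝ :=
  sSup (N.rateRegion B f ζ r)

end Network

/-- `Rank(T_J)`: the rank of the submatrix of the rows with index in `J`. -/
def rowRank {F : Type*} [Field F] {s k : ℕ} (T : Matrix (Fin s) (Fin k) F)
    (J : Finset (Fin s)) : ℕ :=
  (T.submatrix (fun i : J => (i : Fin s)) id).rank

/-- The linear target function with coefficient matrix `T`. -/
def linearTarget {F : Type*} [Field F] {s k : ℕ} (T : Matrix (Fin s) (Fin k) F) :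
    (Fin s → F) → (Fin k → F) :=
  fun m => Matrix.vecMul m T

end

/-! Bound for one pair `(W, C)`: by security, any source messages can be given keys under which `W`
carries one fixed observation. Since `D_W ⊆ I_C`, the keys outside `I_C` can be frozen as well. The
messages on `C \ W` alone must then distinguish all `ℓ`-tuples of vectors in the row space of
`T_{I_C}`; counting gives `ℓ * Rank ≤ n * |C \ W|` (`Code.mul_rowRank_le`).

Equality of the minima: replacing `W` by a minimum cut from its sources, and then `C \ W` by a
minimum cut towards the sink, keeps every cut-off source cut off and adds no edges to the numerator,
so the ratio does not grow (`exists_bottom_top_ratio_le`). Conversely, a reduced pair `(W, C)` is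
the ordinary pair `(W, W ∪ C)`.

Bottom and top elements: two minimum cuts uncross, so by finiteness one minimum cut separates all
the others (`exists_closest_minSeparates`). It serves the whole class, and antisymmetry makes it
unique. `Reach` has an abstract start and relation, so cuts towards the sink are the same theory on
reversed edges. -/

/-! ### Separating sets with respect to a relation -/

section Separation

open Relation

variable {E : Type*}

/-- `e` can be reached along `r` from an element that satisfies `S`, without using `X`. -/
inductive Reach (S : E → Prop) (r : E → E → Prop) (X : Finset E) : E → Prop
  | base {e : E} : S e → e ∉ X → Reach S r X e
  | step {d e : E} : Reach S r X d → r d e → e ∉ X → Reach S r X e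

/-- `C` separates `A` from the elements that satisfy `S`. -/
def Separates (S : E → Prop) (r : E → E → Prop) (A C : Finset E) : Prop :=
  ∀ e ∈ A, ¬ Reach S r C e

/-- `C` is a separating set with the fewest elements. -/
def MinSeparates (S : E → Prop) (r : E → E → Prop) (A C : Finset E) : Prop :=
  Separates S r A C ∧ ∀ C', Separates S r A C' → C.card ≤ C'.card

variable {S : E → Prop} {r : E → E → Prop} {X Y A B C : Finset E} {d e : E}

theorem Reach.notMem (h : Reach S r X e) : e ∉ X := by cases h <;> assumption

theorem Reach.mono (hXY : X ⊆ Y) (h : Reach S r Y e) : Reach S r X e := by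
  induction h with
  | base hs he => exact .base hs fun h => he (hXY h)
  | step _ hr he ih => exact .step ih hr fun h => he (hXY h)

theorem Reach.trans (h : Reach S r X d)
    (hde : ReflTransGen (fun a b => r a b ∧ b ∉ X) d e) : Reach S r X e := by
  induction hde with
  | refl => exact h
  | tail _ hr ih => exact .step ih hr.1 hr.2

theorem reach_iff : Reach S r X e ↔
    ∃ d, S d ∧ d ∉ X ∧ ReflTransGen (fun a b => r a b ∧ b ∉ X) d e := by
  constructor
  · intro h
    induction h with
    | base hs he => exact ⟨_, hs, he, .refl⟩
    | step _ hr he ih =>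
      obtain ⟨d, hs, hd, hp⟩ := ih
      exact ⟨d, hs, hd, hp.tail ⟨hr, he⟩⟩
  · rintro ⟨d, hs, hd, hp⟩
    exact (Reach.base hs hd).trans hp

/-- Each element of a walk avoiding `C` is itself reached avoiding `C`, hence is not in `B`.
Transitivity of separation rests on this. -/
theorem Reach.of_separates (hBC : Separates S r B C) (h : Reach S r C e) : Reach S r B e := by
  induction h with
  | base hs he => exact .base hs fun h => hBC _ h (.base hs he)
  | step hd hr he ih => exact .step ih hr fun h => hBC _ h (.step hd hr he)

theorem Separates.self : Separates S r A A := fun _ he h => h.notMem he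

theorem Separates.trans (hAB : Separates S r A B) (hBC : Separates S r B C) : Separates S r A C :=
  fun e he h => hAB e he (h.of_separates hBC)

/-- Either the walk misses `d`, or its part from a visit to `d` onwards leads from `d` to `e`. -/
theorem Reach.erase_or (h : Reach S r (X.erase d) e) : Reach S r X e ∨ ReflTransGen r d e := by
  induction h with
  | @base e hs he =>
    by_cases h : e = d
    · exact .inr (h ▸ .refl)
    · exact .inl (.base hs fun h' => he (Finset.mem_erase.2 ⟨h, h'⟩))
  | @step c e _ hr he ih =>
    by_cases h : e = d
    · exact .inr (h ▸ .refl)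
    · rcases ih with ih | ih
      · exact .inl (.step ih hr fun h' => he (Finset.mem_erase.2 ⟨h, h'⟩))
      · exact .inr (ih.tail hr)

/-- The elements of `B` that can be reached without using another element of `B`. -/
noncomputable def firstHits (S : E → Prop) (r : E → E → Prop) (B : Finset E) : Finset E :=
  B.filter fun e => Reach S r (B.erase e) e

/-- The elements of `B` from which `A` can be reached without using another element of `B`. -/
noncomputable def lastHits (r : E → E → Prop) (A B : Finset E) : Finset E :=
  B.filter fun e => ∃ a ∈ A, ReflTransGen (fun a b => r a b ∧ b ∉ B) e a

/-- The first element of `B` on a walk is a first hit, so a walk without first hits never meets `B`.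
-/
theorem separates_firstHits : Separates S r B (firstHits S r B) := by
  have key : ∀ e, Reach S r (firstHits S r B) e → Reach S r B e := by
    intro e h
    induction h with
    | base hs he =>
      refine .base hs fun h => he (Finset.mem_filter.2 ⟨h, .base hs ?_⟩)
      exact Finset.notMem_erase _ _
    | step _ hr he ih =>
      refine .step ih hr fun h => he (Finset.mem_filter.2 ⟨h, .step ?_ hr ?_⟩)
      · exact ih.mono (Finset.erase_subset _ _)
      · exact Finset.notMem_erase _ _
  exact fun e he h => (key e h).notMem he

theorem separates_lastHits (h : Separates S r A B) : Separates S r A (lastHits r A B) := by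
  -- The walk is peeled off from its end: the suffix leading to `A` avoids `B` and grows, since an
  -- element of `B` met next would be a last hit.
  have key : ∀ e, Reach S r (lastHits r A B) e →
      (∃ a ∈ A, ReflTransGen (fun a b => r a b ∧ b ∉ B) e a) → Reach S r B e := by
    intro e h
    induction h with
    | base hs he => exact fun hc => .base hs fun h => he (Finset.mem_filter.2 ⟨h, hc⟩)
    | step _ hr he ih =>
      intro hc
      have hB := fun h => he (Finset.mem_filter.2 ⟨h, hc⟩)
      obtain ⟨a, ha, hp⟩ := hc
      exact .step (ih ⟨a, ha, .head ⟨hr, hB⟩ hp⟩) hr hB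
  exact fun e he hr => h e he (key e hr ⟨e, he, .refl⟩)

/-- At an element outside `C` that is both a first and a last hit, the two partial walks glue to a
walk into `A` avoiding `C`. -/
theorem firstHits_inter_lastHits_subset (hA : Separates S r A C) (hCB : C ⊆ B) :
    firstHits S r B ∩ lastHits r A B ⊆ C := by
  intro e he
  obtain ⟨h1, h2⟩ := Finset.mem_inter.1 he
  obtain ⟨-, h1⟩ := Finset.mem_filter.1 h1
  obtain ⟨-, a, ha, hp⟩ := Finset.mem_filter.1 h2
  by_contra hC
  refine hA a ha (Reach.trans (h1.mono fun x hx => ?_) (ReflTransGen.mono ?_ _ _ hp))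
  · exact Finset.mem_erase.2 ⟨fun h => hC (h ▸ hx), hCB hx⟩
  · exact fun _ _ h => ⟨h.1, fun h' => h.2 (hCB h')⟩

/-! ### Minimum separating sets: uncrossing, closest cut, antisymmetry -/

theorem MinSeparates.card_eq (h : MinSeparates S r A B) (h' : MinSeparates S r A C) : B.card = C.card :=
  le_antisymm (h.2 _ h'.1) (h'.2 _ h.1)

theorem MinSeparates.self (h : MinSeparates S r A C) : MinSeparates S r C C :=
  ⟨.self, fun _ h' => h.2 _ (h.1.trans h')⟩

theorem MinSeparates.trans (hB : MinSeparates S r A B) (hC : MinSeparates S r B C) : MinSeparates S r A C :=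
  ⟨hB.1.trans hC.1, fun _ h' => (hC.2 _ .self).trans (hB.2 _ h')⟩

/-- Minimum separating sets of `A` have a common lower bound. -/
theorem MinSeparates.firstHits_union (hB : MinSeparates S r A B) (hC : MinSeparates S r A C) :
    MinSeparates S r A (firstHits S r (B ∪ C)) := by
  set L := firstHits S r (B ∪ C)
  set U := lastHits r A (B ∪ C)
  have hBU : Separates S r A (B ∪ C) := fun e he h => hB.1 e he (h.mono Finset.subset_union_left)
  have hL : Separates S r A L := hBU.trans separates_firstHits
  have hU : Separates S r A U := separates_lastHits hBU
  -- Uncrossing: `|L| + |U| ≤ |B ∪ C| + |B ∩ C| = |B| + |C|`, twice the minimum. As `U` separates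
  -- `A`, it has at least the minimum size, so `L` has at most that size.
  have h1 : (L ∪ U).card ≤ (B ∪ C).card :=
    Finset.card_le_card (Finset.union_subset (Finset.filter_subset _ _) (Finset.filter_subset _ _))
  have h2 : (L ∩ U).card ≤ (B ∩ C).card :=
    Finset.card_le_card (Finset.subset_inter
      (firstHits_inter_lastHits_subset hB.1 Finset.subset_union_left)
      (firstHits_inter_lastHits_subset hC.1 Finset.subset_union_right))
  have h3 := Finset.card_union_add_card_inter L U
  have h4 := Finset.card_union_add_card_inter B C
  have h5 := hB.2 _ hU
  have h6 := hB.card_eq hC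
  exact ⟨hL, fun C' hC' => by have := hB.2 _ hC'; omega⟩

theorem exists_minSeparates [Finite E] (S : E → Prop) (r : E → E → Prop) (A : Finset E) :
    ∃ C, MinSeparates S r A C := by
  obtain ⟨C, hC, h⟩ := Set.exists_min_image {C | Separates S r A C} Finset.card (Set.toFinite _)
    ⟨A, .self⟩
  exact ⟨C, hC, h⟩

/-- There is a minimum separating set of `A` that separates all the others. -/
theorem exists_closest_minSeparates [Finite E] (S : E → Prop) (r : E → E → Prop) (A : Finset E) :
    ∃ p, MinSeparates S r A p ∧ ∀ C, MinSeparates S r A C → Separates S r C p := by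
  have : Fintype E := Fintype.ofFinite E
  have key : ∀ s : Finset (Finset E), ∃ p, MinSeparates S r A p ∧
      ∀ C ∈ s, MinSeparates S r A C → Separates S r C p := by
    intro s
    induction s using Finset.induction_on with
    | empty => simpa using exists_minSeparates S r A
    | insert C s _ ih =>
      obtain ⟨p, hp, h⟩ := ih
      by_cases hC : MinSeparates S r A C
      · refine ⟨_, hp.firstHits_union hC, fun D hD hDA => ?_⟩
        rcases Finset.mem_insert.1 hD with rfl | hD
        · exact fun e he => separates_firstHits e (Finset.mem_union_right _ he)
        · exact (h D hD hDA).trans fun e he => separates_firstHits e (Finset.mem_union_left _ he)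
      · refine ⟨p, hp, fun D hD hDA => ?_⟩
        rcases Finset.mem_insert.1 hD with rfl | hD
        · exact absurd hDA hC
        · exact h D hD hDA
  obtain ⟨p, hp, h⟩ := key Finset.univ
  exact ⟨p, hp, fun C => h C (Finset.mem_univ _)⟩

/-- A common minimum cut `C` transfers the closest cut of `A` to `A'`: `B` separates `C`, which
separates `A'`, and the sizes agree. Hence one closest cut serves a whole class. -/
theorem MinSeparates.of_closest (hp : MinSeparates S r A B) (h : ∀ C, MinSeparates S r A C → Separates S r C B)
    {A' : Finset E} (hA : MinSeparates S r A C) (hA' : MinSeparates S r A' C) : MinSeparates S r A' B :=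
  ⟨hA'.1.trans (h C hA), fun C' hC' => (hp.card_eq hA).le.trans (hA'.2 C' hC')⟩

/-- A first hit of `B ∪ C` lying in only one of the two sets would be reached avoiding the other,
which separates it. So the first hits lie in `C ∩ B`; they separate `B`, and minimality of `C`
forces `C ∩ B = C`. -/
theorem MinSeparates.subset (h : MinSeparates S r B C) (h' : Separates S r C B) : C ⊆ B := by
  have hL : firstHits S r (B ∪ C) ⊆ C ∩ B := by
    intro e he
    obtain ⟨heB, he⟩ := Finset.mem_filter.1 he
    have aux : ∀ D ⊆ B ∪ C, e ∉ D → Reach S r D e := fun D hD heD =>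
      he.mono fun x hx => Finset.mem_erase.2 ⟨fun (h : x = e) => heD (h ▸ hx), hD hx⟩
    by_cases h1 : e ∈ B
    · refine Finset.mem_inter.2 ⟨?_, h1⟩
      by_contra h2
      exact h.1 e h1 (aux C Finset.subset_union_right h2)
    · have h2 : e ∈ C := (Finset.mem_union.1 heB).resolve_left h1
      exact absurd (aux B Finset.subset_union_left h1) (h' e h2)
  have h1 := h.2 _ fun e he => separates_firstHits (B := B ∪ C) e (Finset.mem_union_left _ he)
  have h2 := Finset.eq_of_subset_of_card_le Finset.inter_subset_left
    (h1.trans (Finset.card_le_card hL))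
  exact Finset.inter_eq_left.1 h2

theorem MinSeparates.antisymm (h : MinSeparates S r B C) (h' : MinSeparates S r C B) : B = C :=
  (h'.subset h.1).antisymm (h.subset h'.1)

/-- An element with no path to `A` could be dropped from the cut. -/
theorem MinSeparates.exists_path (h : MinSeparates S r A C) (he : e ∈ C) : ∃ a ∈ A, ReflTransGen r e a := by
  by_contra hno
  have : Separates S r A (C.erase e) := fun a ha hr =>
    hr.erase_or.elim (h.1 a ha) fun hp => hno ⟨a, ha, hp⟩
  exact absurd (h.2 _ this) (not_le.2 (Finset.card_erase_lt_of_mem he))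

theorem sInf_card_eq_iff :
    A.card = sInf {c | ∃ C : Finset E, Separates S r A C ∧ C.card = c} ↔ MinSeparates S r A A := by
  constructor
  · exact fun h => ⟨.self, fun C hC => h.le.trans (Nat.sInf_le ⟨C, hC, rfl⟩)⟩
  · intro h
    refine le_antisymm (le_csInf ⟨_, A, .self, rfl⟩ ?_) (Nat.sInf_le ⟨A, .self, rfl⟩)
    rintro _ ⟨C, hC, rfl⟩
    exact h.2 C hC

end Separation
namespace Network

open Relation

variable {V E : Type*} {s : ℕ} (N : Network V E s)

/-! ### Cuts from the sources as separating sets -/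

theorem nodeEdgePath_iff {X : Finset E} {u : V} {e : E} :
    N.NodeEdgePath X u e ↔ Reach (fun d => N.tail d = u) (fun a b => N.head a = N.tail b) X e :=
  reach_iff.symm

theorem isCutFromSources_iff {U : Finset (Fin s)} {A C : Finset E} :
    N.IsCutFromSources U A C ↔ Separates (fun d => ∃ i ∈ U, N.tail d = N.source i)
      (fun a b => N.head a = N.tail b) A C := by
  constructor
  · intro h e he hr
    obtain ⟨d, ⟨i, hi, hd⟩, hp⟩ := reach_iff.1 hr
    exact h i hi e he ⟨d, hd, hp⟩
  · rintro h i hi e he ⟨d, hd, hp⟩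
    exact h e he (reach_iff.2 ⟨d, ⟨i, hi, hd⟩, hp⟩)

theorem mem_MINCUTFromSources_iff {U : Finset (Fin s)} {A C : Finset E} :
    C ∈ N.MINCUTFromSources U A ↔ MinSeparates (fun d => ∃ i ∈ U, N.tail d = N.source i)
      (fun a b => N.head a = N.tail b) A C := by
  simp only [MINCUTFromSources, MinSeparates, isCutFromSources_iff, Set.mem_ofPred_eq]

theorem card_eq_mincutFromSources_iff {U : Finset (Fin s)} {A : Finset E} :
    A.card = N.mincutFromSources U A ↔ A ∈ N.MINCUTFromSources U A := by
  simp only [mincutFromSources, isCutFromSources_iff, mem_MINCUTFromSources_iff, sInf_card_eq_iff]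

theorem mem_D {C : Finset E} {i : Fin s} :
    i ∈ N.D C ↔ ∃ e ∈ C, N.NodeEdgePath ∅ (N.source i) e := by
  simp [D]

variable {N} in
theorem NodeEdgePath.trans {u : V} {d e : E} (h : N.NodeEdgePath ∅ u d)
    (hp : ReflTransGen (fun a b => N.head a = N.tail b) d e) : N.NodeEdgePath ∅ u e := by
  rw [nodeEdgePath_iff] at *
  exact h.trans (ReflTransGen.mono (fun _ _ h => ⟨h, Finset.notMem_empty _⟩) _ _ hp)

theorem D_subset_of_isCutFromSources {A C : Finset E}
    (h : N.IsCutFromSources (N.D A) A C) : N.D A ⊆ N.D C := by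
  intro i hi
  by_contra hC
  obtain ⟨e, he, hp⟩ := N.mem_D.1 hi
  refine h i hi e he ?_
  rw [nodeEdgePath_iff] at hp ⊢
  have key : ∀ e ∈ C, ¬ Reach (fun d => N.tail d = N.source i)
      (fun a b => N.head a = N.tail b) ∅ e := fun e he hp =>
    hC (N.mem_D.2 ⟨e, he, N.nodeEdgePath_iff.2 hp⟩)
  clear he
  induction hp with
  | base hs _ => exact .base hs fun h => key _ h (.base hs (Finset.notMem_empty _))
  | step hd hr _ ih =>
    exact .step ih hr fun h => key _ h (.step hd hr (Finset.notMem_empty _))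

/-- Every edge of a minimum cut leads to `A`, so a source reaching the cut reaches `A`. Consequently
`D` is constant on each class, and all cuts there refer to the same sources. -/
theorem D_eq_of_mem_MINCUTFromSources {A C : Finset E}
    (h : C ∈ N.MINCUTFromSources (N.D A) A) : N.D C = N.D A := by
  refine subset_antisymm (fun i hi => ?_) (N.D_subset_of_isCutFromSources h.1)
  obtain ⟨e, he, hp⟩ := N.mem_D.1 hi
  obtain ⟨a, ha, hea⟩ := (N.mem_MINCUTFromSources_iff.1 h).exists_path he
  exact N.mem_D.2 ⟨a, ha, hp.trans hea⟩

theorem mem_wiretapStar_of_mem_MINCUTFromSources {r : ℕ} {A C : Finset E} (hA : A.card ≤ r)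
    (h : C ∈ N.MINCUTFromSources (N.D A) A) : C ∈ N.wiretapStar r := by
  refine ⟨?_, (h.2 A ?_).trans hA⟩
  · rw [card_eq_mincutFromSources_iff, D_eq_of_mem_MINCUTFromSources N h,
      mem_MINCUTFromSources_iff]
    exact (N.mem_MINCUTFromSources_iff.1 h).self
  · exact N.isCutFromSources_iff.2 .self

theorem sourceLE_antisymm {α β : Finset E} (h : N.SourceLE α β) (h' : N.SourceLE β α) :
    α = β := by
  have hD := N.D_eq_of_mem_MINCUTFromSources h
  unfold SourceLE at h h'
  rw [mem_MINCUTFromSources_iff] at h h'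
  rw [hD] at h'
  exact h'.antisymm h

theorem sourceEquiv_self {r : ℕ} {α : Finset E} (h : α ∈ N.wiretapStar r) :
    N.SourceEquiv α α :=
  ⟨α, N.card_eq_mincutFromSources_iff.1 h.1, N.card_eq_mincutFromSources_iff.1 h.1⟩

/-- The bottom element is the closest minimum cut of any representative. -/
theorem exists_isBottomOf [Finite E] {r : ℕ} {Cl : Set (Finset E)}
    (h : Cl ∈ N.sourceClasses r) : ∃ b, N.IsBottomOf Cl b := by
  obtain ⟨α, hα, rfl⟩ := h
  obtain ⟨p, hp, hpc⟩ := exists_closest_minSeparates (fun d => ∃ i ∈ N.D α, N.tail d = N.source i)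
    (fun a b => N.head a = N.tail b) α
  have hp' := N.mem_MINCUTFromSources_iff.2 hp
  have hDp := N.D_eq_of_mem_MINCUTFromSources hp'
  refine ⟨p, ⟨N.mem_wiretapStar_of_mem_MINCUTFromSources hα.2 hp', p, hp', ?_⟩, ?_⟩
  · rw [hDp, mem_MINCUTFromSources_iff]
    exact hp.self
  · rintro β ⟨hβ, ξ, hξα, hξβ⟩
    have hD : N.D β = N.D α :=
      (N.D_eq_of_mem_MINCUTFromSources hξβ).symm.trans (N.D_eq_of_mem_MINCUTFromSources hξα)
    rw [mem_MINCUTFromSources_iff] at hξα hξβ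
    rw [hD] at hξβ
    rw [SourceLE, hD, mem_MINCUTFromSources_iff]
    exact hp.of_closest hpc hξα hξβ

theorem existsUnique_isBottomOf [Finite E] {r : ℕ} {Cl : Set (Finset E)}
    (h : Cl ∈ N.sourceClasses r) : ∃! b, N.IsBottomOf Cl b := by
  obtain ⟨b, hb⟩ := N.exists_isBottomOf h
  exact ⟨b, hb, fun c hc => N.sourceLE_antisymm (hc.2 b hb.1) (hb.2 c hc.1)⟩

theorem wiretapHat_subset (r : ℕ) : N.wiretapHat r ⊆ N.wiretapStar r := by
  rintro b ⟨_, ⟨α, _, rfl⟩, hb⟩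
  exact hb.1.1

/-- Each edge set of size at most `r` has a minimum cut that is a bottom element. -/
theorem exists_mem_wiretapHat [Finite E] {r : ℕ} {W : Finset E} (hW : W.card ≤ r) :
    ∃ W' ∈ N.wiretapHat r, W' ∈ N.MINCUTFromSources (N.D W) W := by
  obtain ⟨W₀, h₀⟩ := exists_minSeparates (fun d => ∃ i ∈ N.D W, N.tail d = N.source i)
    (fun a b => N.head a = N.tail b) W
  have h₀' := N.mem_MINCUTFromSources_iff.2 h₀
  have hs := N.mem_wiretapStar_of_mem_MINCUTFromSources hW h₀'
  have hCl : {β | β ∈ N.wiretapStar r ∧ N.SourceEquiv W₀ β} ∈ N.sourceClasses r := ⟨W₀, hs, rfl⟩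
  obtain ⟨b, hb⟩ := N.exists_isBottomOf hCl
  refine ⟨b, ⟨_, hCl, hb⟩, ?_⟩
  have := hb.2 W₀ ⟨hs, N.sourceEquiv_self hs⟩
  rw [SourceLE, N.D_eq_of_mem_MINCUTFromSources h₀', mem_MINCUTFromSources_iff] at this
  exact N.mem_MINCUTFromSources_iff.2 (h₀.trans this)

/-! ### Cuts to the sink as separating sets -/

variable {N} in
theorem EdgeNodePath.notMem {X : Finset E} {d : E} {v : V} (h : N.EdgeNodePath X d v) :
    d ∉ X := h.choose_spec.1.1

variable {N} in
theorem EdgeNodePath.cons {X : Finset E} {d e : E} {v : V} (h : N.EdgeNodePath X d v)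
    (hed : N.head e = N.tail d) (he : e ∉ X) : N.EdgeNodePath X e v := by
  obtain ⟨f, ⟨hd, hp⟩, hf⟩ := h
  exact ⟨f, ⟨he, .head ⟨hed, hd⟩ hp⟩, hf⟩

/-- Walks run backwards from the sink. Deletion of `W` is built into the start predicate and the
relation, leaving `C` as the separating set. -/
theorem edgeNodePath_iff {W C : Finset E} {e : E} {v : V} :
    N.EdgeNodePath (W ∪ C) e v ↔ Reach (fun d => N.head d = v ∧ d ∉ W)
      (fun a b => N.head b = N.tail a ∧ b ∉ W) C e := by
  constructor
  · rintro ⟨f, ⟨he, hp⟩, hf⟩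
    revert he
    induction hp using ReflTransGen.head_induction_on with
    | refl =>
      intro he
      rw [Finset.notMem_union] at he
      exact .base ⟨hf, he.1⟩ he.2
    | head h _ ih =>
      intro he
      rw [Finset.notMem_union] at he
      exact .step (ih h.2) ⟨h.1, he.1⟩ he.2
  · intro h
    induction h with
    | base hs he => exact ⟨_, ⟨Finset.notMem_union.2 ⟨hs.2, he⟩, .refl⟩, hs.1⟩
    | step _ hr he ih => exact ih.cons hr.1 (Finset.notMem_union.2 ⟨hr.2, he⟩)

theorem nodePath_iff {X : Finset E} {u v : V} :
    N.NodePath X u v ↔ ∃ d, N.tail d = u ∧ N.EdgeNodePath X d v :=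
  ⟨fun ⟨d, e, hd, hp, he⟩ => ⟨d, hd, e, hp, he⟩, fun ⟨d, hd, e, hp, he⟩ => ⟨d, e, hd, hp, he⟩⟩

theorem isCutToSink_iff {W A C : Finset E} :
    N.IsCutToSink W A C ↔ Disjoint C W ∧ Separates (fun d => N.head d = N.sink ∧ d ∉ W)
      (fun a b => N.head b = N.tail a ∧ b ∉ W) A C := by
  simp only [IsCutToSink, Separates, edgeNodePath_iff]

theorem IsCutToSink.of_separates {W A C : Finset E}
    (h : Separates (fun d => N.head d = N.sink ∧ d ∉ W)
      (fun a b => N.head b = N.tail a ∧ b ∉ W) A C) : N.IsCutToSink W A (C \ W) := by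
  refine ⟨Finset.sdiff_disjoint, fun e he hp => h e he ?_⟩
  rw [Finset.union_sdiff_self_eq_union] at hp
  exact N.edgeNodePath_iff.1 hp

/-- Edges of `W` are never reached, so removing them from a cut keeps it separating. Thus minimizing
over all sets or over those disjoint from `W` is the same, and minimum sets are automatically
disjoint from `W`. -/
theorem mem_MINCUTToSink_iff {W A C : Finset E} :
    C ∈ N.MINCUTToSink W A ↔ MinSeparates (fun d => N.head d = N.sink ∧ d ∉ W)
      (fun a b => N.head b = N.tail a ∧ b ∉ W) A C := by
  constructor
  · rintro ⟨h, hmin⟩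
    exact ⟨(N.isCutToSink_iff.1 h).2, fun C' hC' =>
      (hmin _ (IsCutToSink.of_separates N hC')).trans (Finset.card_le_card Finset.sdiff_subset)⟩
  · rintro ⟨h, hmin⟩
    have hcut := IsCutToSink.of_separates N h
    have hC : C \ W = C := Finset.eq_of_subset_of_card_le Finset.sdiff_subset
      (hmin _ (N.isCutToSink_iff.1 hcut).2)
    rw [hC] at hcut
    exact ⟨hcut, fun C' hC' => hmin _ (N.isCutToSink_iff.1 hC').2⟩

theorem card_eq_mincutToSink_iff {W A : Finset E} (hA : Disjoint A W) :
    A.card = N.mincutToSink W A ↔ A ∈ N.MINCUTToSink W A := by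
  constructor
  · exact fun h => ⟨N.isCutToSink_iff.2 ⟨hA, .self⟩, fun C hC => h.le.trans
      (Nat.sInf_le ⟨C, hC, rfl⟩)⟩
  · rintro ⟨h, hmin⟩
    refine le_antisymm (le_csInf ⟨_, A, h, rfl⟩ ?_) (Nat.sInf_le ⟨A, h, rfl⟩)
    rintro _ ⟨C, hC, rfl⟩
    exact hmin C hC

theorem mem_I {C : Finset E} {i : Fin s} : i ∈ N.I C ↔ ¬ N.NodePath C (N.source i) N.sink := by
  simp [I]

theorem IRes_subset_of_isCutToSink {W A C : Finset E} (h : N.IsCutToSink W A C) :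
    N.IRes W A ⊆ N.IRes W C := by
  intro i hi
  simp only [IRes, Finset.mem_filter, Finset.mem_univ, true_and] at hi ⊢
  intro hp
  refine hi ?_
  rw [nodePath_iff] at hp ⊢
  obtain ⟨d, hd, hp⟩ := hp
  rw [edgeNodePath_iff] at hp
  exact ⟨d, hd, N.edgeNodePath_iff.2 (hp.of_separates (N.isCutToSink_iff.1 h).2)⟩

theorem mem_cutStar_of_mem_MINCUTToSink {W A C : Finset E} (hI : (N.IRes W A).Nonempty)
    (hD : N.D W ⊆ N.IRes W A) (h : C ∈ N.MINCUTToSink W A) : C ∈ N.cutStar W := by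
  have hsub := N.IRes_subset_of_isCutToSink h.1
  refine ⟨⟨h.1.1, hI.mono hsub⟩, ?_, hD.trans hsub⟩
  rw [N.card_eq_mincutToSink_iff h.1.1, mem_MINCUTToSink_iff]
  exact (N.mem_MINCUTToSink_iff.1 h).self

theorem mem_MINCUTToSink_self {W C : Finset E} (h : C ∈ N.cutStar W) : C ∈ N.MINCUTToSink W C :=
  (N.card_eq_mincutToSink_iff h.1.1).1 h.2.1

theorem exists_isTopOf [Finite E] {W : Finset E} {Cl : Set (Finset E)}
    (h : Cl ∈ N.sinkClasses W) : ∃ t, N.IsTopOf W Cl t := by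
  obtain ⟨α, hα, rfl⟩ := h
  obtain ⟨p, hp, hpc⟩ := exists_closest_minSeparates (fun d => N.head d = N.sink ∧ d ∉ W)
    (fun a b => N.head b = N.tail a ∧ b ∉ W) α
  have hp' := N.mem_MINCUTToSink_iff.2 hp
  refine ⟨p, ⟨N.mem_cutStar_of_mem_MINCUTToSink hα.1.2 hα.2.2 hp', p, hp', ?_⟩, ?_⟩
  · exact N.mem_MINCUTToSink_iff.2 hp.self
  · rintro β ⟨hβ, ξ, hξα, hξβ⟩
    rw [mem_MINCUTToSink_iff] at hξα hξβ
    exact N.mem_MINCUTToSink_iff.2 (hp.of_closest hpc hξα hξβ)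

theorem existsUnique_isTopOf [Finite E] {W : Finset E} {Cl : Set (Finset E)}
    (h : Cl ∈ N.sinkClasses W) : ∃! t, N.IsTopOf W Cl t := by
  obtain ⟨t, ht⟩ := N.exists_isTopOf h
  refine ⟨t, ht, fun u hu => ?_⟩
  exact (N.mem_MINCUTToSink_iff.1 (ht.2 u hu.1)).antisymm (N.mem_MINCUTToSink_iff.1 (hu.2 t ht.1))

theorem cutHat_subset (W : Finset E) : N.cutHat W ⊆ N.cutStar W := by
  rintro t ⟨_, ⟨α, _, rfl⟩, ht⟩
  exact ht.1.1

/-- Each edge set that cuts off `D_W` in `G_W` has a minimum cut that is a top element. -/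
theorem exists_mem_cutHat [Finite E] {W C : Finset E} (hI : (N.IRes W C).Nonempty)
    (hD : N.D W ⊆ N.IRes W C) : ∃ C' ∈ N.cutHat W, C' ∈ N.MINCUTToSink W C := by
  obtain ⟨C₀, h₀⟩ := exists_minSeparates (fun d => N.head d = N.sink ∧ d ∉ W)
    (fun a b => N.head b = N.tail a ∧ b ∉ W) C
  have hs := N.mem_cutStar_of_mem_MINCUTToSink hI hD (N.mem_MINCUTToSink_iff.2 h₀)
  have hCl : {β | β ∈ N.cutStar W ∧ N.SinkEquiv W C₀ β} ∈ N.sinkClasses W := ⟨C₀, hs, rfl⟩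
  obtain ⟨t, ht⟩ := N.exists_isTopOf hCl
  refine ⟨t, ⟨_, hCl, ht⟩, ?_⟩
  have := ht.2 C₀ ⟨hs, C₀, N.mem_MINCUTToSink_self hs, N.mem_MINCUTToSink_self hs⟩
  exact N.mem_MINCUTToSink_iff.2 (h₀.trans (N.mem_MINCUTToSink_iff.1 this))

theorem cutHat_nonempty [Finite E] (hs : 0 < s) (W : Finset E) : (N.cutHat W).Nonempty := by
  have : Fintype E := Fintype.ofFinite E
  have huniv : N.IRes W Finset.univ = Finset.univ := by
    refine Finset.filter_true_of_mem fun i _ => ?_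
    rw [nodePath_iff]
    rintro ⟨d, -, hp⟩
    exact hp.notMem (Finset.mem_union_right _ (Finset.mem_univ d))
  obtain ⟨C, hC, -⟩ := N.exists_mem_cutHat (W := W) (C := Finset.univ)
    (huniv ▸ ⟨⟨0, hs⟩, Finset.mem_univ _⟩) (huniv ▸ Finset.subset_univ _)
  exact ⟨C, hC⟩

/-- Replacing a part of `C` by a cut of this part cuts off at least as many sources. -/
theorem I_subset_of_isCutFromSources {W W' C : Finset E}
    (h : N.IsCutFromSources (N.D W) W W') : N.I C ⊆ N.I (W' ∪ C \ W) := by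
  intro i hi
  rw [mem_I, nodePath_iff] at *
  rintro ⟨d, hd, f, ⟨hdX, hp⟩, hf⟩
  refine hi ⟨d, hd, f, ?_, hf⟩
  -- An edge of `C` on the path would lie in `W`, so the path's source is in `D_W` and reaches `W`
  -- while avoiding `W'`, against the cut property.
  have hW : ∀ e, e ∉ W' ∪ C \ W →
      ReflTransGen (fun a b => N.head a = N.tail b ∧ b ∉ W' ∪ C \ W) d e → e ∉ C := by
    intro e heX hp' he
    have heW : e ∈ W := by
      by_contra heW
      exact heX (Finset.mem_union_right _ (Finset.mem_sdiff.2 ⟨he, heW⟩))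
    have hpath : N.NodeEdgePath W' (N.source i) e :=
      ⟨d, hd, fun h' => hdX (Finset.mem_union_left _ h'), ReflTransGen.mono
        (fun _ _ h' => ⟨h'.1, fun h'' => h'.2 (Finset.mem_union_left _ h'')⟩) _ _ hp'⟩
    refine h i (N.mem_D.2 ⟨e, heW, ?_⟩) e heW hpath
    rw [nodeEdgePath_iff] at hpath ⊢
    exact hpath.mono (Finset.empty_subset _)
  refine ⟨hW d hdX .refl, ?_⟩
  clear hf
  induction hp with
  | refl => exact .refl
  | tail hp hr ih => exact ih.tail ⟨hr.1, hW _ hr.2 (hp.tail hr)⟩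

end Network
namespace Network

variable {V E : Type*} {s : ℕ} {N : Network V E s}

namespace Code

variable {A B O : Type*} {ℓ n : ℕ} [Finite E]

/-! ### Dependence of the messages on the sources -/

theorem globalEnc_congr (c : N.Code A B O ℓ n) {m m' : Fin s → Fin ℓ → A}
    {κ κ' : ∀ i, c.Key i} (e : E)
    (h : ∀ i, N.NodeEdgePath ∅ (N.source i) e → m i = m' i ∧ κ i = κ' i) :
    c.globalEnc m κ e = c.globalEnc m' κ' e := by
  induction e using N.wellFounded_edges.induction with
  | _ e ih =>
    by_cases hs : ∃ i, N.tail e = N.source i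
    · obtain ⟨i, hi⟩ := hs
      obtain ⟨hm, hκ⟩ := h i ⟨e, hi, Finset.notMem_empty _, .refl⟩
      rw [c.globalEnc_source _ _ i e hi, c.globalEnc_source _ _ i e hi, hm, hκ]
    · rw [c.globalEnc_relay _ _ e hs, c.globalEnc_relay _ _ e hs]
      congr 1
      funext d
      exact ih d.1 d.2 fun i hp => h i (hp.trans (.single d.2))

/-- An edge outside `C` that reaches the sink avoiding `C` starts at a source outside `I_C`, or else
its input edges are in `C` or again of this kind. The hypothesis `he` is the invariant of this
backward recursion. -/
theorem globalEnc_congr_of_cut (c : N.Code A B O ℓ n) {m m' : Fin s → Fin ℓ → A}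
    {κ κ' : ∀ i, c.Key i} {C : Finset E}
    (hC : ∀ e ∈ C, c.globalEnc m κ e = c.globalEnc m' κ' e)
    (h : ∀ i ∉ N.I C, m i = m' i ∧ κ i = κ' i) (e : E)
    (he : e ∉ C → N.EdgeNodePath C e N.sink) :
    c.globalEnc m κ e = c.globalEnc m' κ' e := by
  induction e using N.wellFounded_edges.induction with
  | _ e ih =>
    by_cases heC : e ∈ C
    · exact hC e heC
    by_cases hs : ∃ i, N.tail e = N.source i
    · obtain ⟨i, hi⟩ := hs
      obtain ⟨hm, hκ⟩ := h i (by
        rw [mem_I, not_not, nodePath_iff]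
        exact ⟨e, hi, he heC⟩)
      rw [c.globalEnc_source _ _ i e hi, c.globalEnc_source _ _ i e hi, hm, hκ]
    · rw [c.globalEnc_relay _ _ e hs, c.globalEnc_relay _ _ e hs]
      congr 1
      funext d
      exact ih d.1 d.2 fun hd => (he heC).cons d.2 hd

/-! ### Security -/

/-- Each value of the messages on a wiretap set is compatible with all source messages. -/
theorem Secure.exists_key [Finite A] {c : N.Code A B O ℓ n} {r : ℕ}
    (hc : c.Secure (id : (Fin s → A) → Fin s → A) r) {W : Finset E} (hW : W.card ≤ r)
    (m m₀ : Fin s → Fin ℓ → A) (κ₀ : ∀ i, c.Key i) :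
    ∃ κ, ∀ e ∈ W, c.globalEnc m κ e = c.globalEnc m₀ κ₀ e := by
  have := c.keyFinite
  let _ : MeasurableSpace ((Fin s → Fin ℓ → A) × (∀ i, c.Key i)) := ⊤
  let _ : MeasurableSpace (W → Fin n → B) := ⊤
  let _ : MeasurableSpace (Fin ℓ → Fin s → A) := ⊤
  let Y : (Fin s → Fin ℓ → A) × (∀ i, c.Key i) → W → Fin n → B := fun ω e =>
    c.globalEnc ω.1 ω.2 e.1
  let Z : (Fin s → Fin ℓ → A) × (∀ i, c.Key i) → Fin ℓ → Fin s → A := fun ω j i => ω.1 i j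
  have key := (hc W hW).measure_inter_preimage_eq_mul {Y (m₀, κ₀)} {Z (m, κ₀)} trivial trivial
  change ProbabilityTheory.uniformOn Set.univ (Y ⁻¹' {Y (m₀, κ₀)} ∩ Z ⁻¹' {Z (m, κ₀)}) =
    ProbabilityTheory.uniformOn Set.univ (Y ⁻¹' {Y (m₀, κ₀)}) *
      ProbabilityTheory.uniformOn Set.univ (Z ⁻¹' {Z (m, κ₀)}) at key
  -- On a finite uniform space nonempty events have positive probability. Independence then makes
  -- the joint event nonempty, and a point of it supplies the key.
  have hne : ∀ (t : Set ((Fin s → Fin ℓ → A) × (∀ i, c.Key i))) (x), x ∈ t →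
      ProbabilityTheory.uniformOn Set.univ t ≠ 0 := fun t x hx h0 => by
    rw [ProbabilityTheory.uniformOn_eq_zero_iff Set.finite_univ, Set.univ_inter] at h0
    exact Set.notMem_empty x (h0 ▸ hx)
  have hpos := mul_ne_zero (hne (Y ⁻¹' {Y (m₀, κ₀)}) (m₀, κ₀) rfl)
    (hne (Z ⁻¹' {Z (m, κ₀)}) (m, κ₀) rfl)
  rw [← key] at hpos
  obtain ⟨⟨m', κ⟩, h1, h2⟩ := MeasureTheory.nonempty_of_measure_ne_zero hpos
  have hm : m' = m := by
    funext i j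
    exact congrFun (congrFun h2 j) i
  subst hm
  exact ⟨κ, fun e he => congrFun h1 ⟨e, he⟩⟩

end Code

/-! ### Row ranks and the counting bound -/

variable {F : Type*} [Field F] {k : ℕ}

theorem finrank_range_vecMulLinear (T : Matrix (Fin s) (Fin k) F) (J : Finset (Fin s)) :
    Module.finrank F
      (LinearMap.range (T.submatrix (fun i : J => (i : Fin s)) id).vecMulLinear) =
      rowRank T J := by
  rw [rowRank, ← Matrix.rank_transpose, Matrix.rank, Matrix.mulVecLin_transpose]

theorem rowRank_mono (T : Matrix (Fin s) (Fin k) F) {J J' : Finset (Fin s)} (h : J ⊆ J') :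
    rowRank T J ≤ rowRank T J' :=
  Matrix.rank_submatrix_le (T.submatrix (fun i : J' => (i : Fin s)) id)
    (fun i : J => (⟨i, h i.2⟩ : J')) id

theorem rowRank_pos {T : Matrix (Fin s) (Fin k) F} (hT : ∀ i, T i ≠ 0) {J : Finset (Fin s)}
    (hJ : J.Nonempty) : 0 < rowRank T J := by
  obtain ⟨i, hi⟩ := hJ
  rw [Nat.pos_iff_ne_zero, ← finrank_range_vecMulLinear, Ne, Submodule.finrank_eq_zero,
    LinearMap.range_eq_bot]
  intro h
  have := LinearMap.congr_fun h (Pi.single ⟨i, hi⟩ 1)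
  rw [Matrix.vecMulLinear_apply, Matrix.single_one_vecMul] at this
  exact hT i this

/-- The converse bound for a single code and a single pair of a wiretap set and a cut set. -/
theorem Code.mul_rowRank_le [Finite E] [Finite F] {ℓ n r : ℕ} {T : Matrix (Fin s) (Fin k) F}
    {c : N.Code F F (Fin k → F) ℓ n} (hcomp : c.Computes (linearTarget T))
    (hsec : c.Secure (id : (Fin s → F) → Fin s → F) r) {W C : Finset E} (hW : W.card ≤ r)
    (hD : N.D W ⊆ N.I C) : ℓ * rowRank T (N.I C) ≤ n * (C \ W).card := by
  set J := N.I C with hJ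
  set L := (T.submatrix (fun i : J => (i : Fin s)) id).vecMulLinear with hL
  have := c.keyNonempty
  let κ₀ : ∀ i, c.Key i := fun i => Classical.arbitrary _
  -- A preimage is fixed for each vector of the row space of `T_J`; padded with zeros outside `J`,
  -- it makes the target take exactly that value.
  choose x hx using fun v : LinearMap.range L => v.2
  let m : (Fin ℓ → LinearMap.range L) → Fin s → Fin ℓ → F := fun g i j =>
    if h : i ∈ J then x (g j) ⟨i, h⟩ else 0
  have hm : ∀ g j, linearTarget T (fun i => m g i j) = g j := by
    intro g j
    rw [← hx (g j)]
    funext l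
    simp only [linearTarget, hL, Matrix.vecMulLinear_apply, Matrix.vecMul, dotProduct,
      Matrix.submatrix_apply, id, m]
    rw [← Finset.sum_subset (Finset.subset_univ J), ← Finset.sum_coe_sort]
    · exact Finset.sum_congr rfl fun i _ => by rw [dif_pos i.2]
    · intro i _ hi
      rw [dif_neg hi, zero_mul]
  -- These keys reproduce on `W` the messages of the zero input. Resetting them to `κ₀` outside `J`
  -- does not affect `W`, which depends only on `D_W ⊆ J`.
  choose κ' hκ' using fun g => hsec.exists_key hW (m g) 0 κ₀
  let κ : (Fin ℓ → LinearMap.range L) → ∀ i, c.Key i := fun g i =>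
    if i ∈ J then κ' g i else κ₀ i
  have hκ : ∀ g, ∀ e ∈ W, c.globalEnc (m g) (κ g) e = c.globalEnc 0 κ₀ e := by
    intro g e he
    rw [← hκ' g e he]
    refine c.globalEnc_congr e fun i hi => ⟨rfl, if_pos (hD (N.mem_D.2 ⟨e, he, hi⟩))⟩
  let Φ : (Fin ℓ → LinearMap.range L) → (C \ W : Finset E) → Fin n → F := fun g e =>
    c.globalEnc (m g) (κ g) e.1
  -- `W` and the sources outside `J` look the same for all `g`, so agreement on `C \ W` gives the
  -- sink equal inputs, and decoding returns `g`.
  have hΦ : Function.Injective Φ := by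
    intro g g' hgg
    have hCeq : ∀ e ∈ C, c.globalEnc (m g) (κ g) e = c.globalEnc (m g') (κ g') e := by
      intro e he
      by_cases heW : e ∈ W
      · rw [hκ g e heW, hκ g' e heW]
      · exact congrFun hgg ⟨e, Finset.mem_sdiff.2 ⟨he, heW⟩⟩
    have hout : ∀ i ∉ J, m g i = m g' i ∧ κ g i = κ g' i := fun i hi => by
      refine ⟨?_, ?_⟩
      · funext j
        simp only [m, dif_neg hi]
      · simp only [κ, if_neg hi]
    have hdec := (hcomp (m g) (κ g)).symm.trans ((congrArg c.dec (funext fun d =>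
      c.globalEnc_congr_of_cut hCeq hout d.1 fun hd => ⟨d.1, ⟨hd, .refl⟩, d.2⟩)).trans
        (hcomp (m g') (κ g')))
    funext j
    have := congrFun hdec j
    rw [hm, hm] at this
    exact Subtype.ext this
  have hcard := Nat.card_le_card_of_injective Φ hΦ
  rw [Nat.card_fun, Nat.card_fun, Nat.card_fun, Module.natCard_eq_pow_finrank (K := F),
    finrank_range_vecMulLinear, Nat.card_fin, Nat.card_fin, Nat.card_eq_fintype_card (α := ↥(C \ W)),
    Fintype.card_coe, ← pow_mul, ← pow_mul,
    Nat.pow_le_pow_iff_right Finite.one_lt_card] at hcard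
  rwa [mul_comm ℓ]

end Network
-- Comparison of the two minima and the capacity
namespace Network

variable {V E F : Type*} [Finite E] [Field F] {s k : ℕ}

theorem exists_bottom_top_ratio_le (N : Network V E s) (T : Matrix (Fin s) (Fin k) F)
    (hT : ∀ i, T i ≠ 0) {r : ℕ} {W C : Finset E} (hW : W.card ≤ r) (hC : C ∈ N.cutSets)
    (hWC : W ⊆ C) (hD : N.D W ⊆ N.I C) : ∃ W' ∈ N.wiretapHat r, ∃ C' ∈ N.cutHat W',
      (C'.card : ℝ) / rowRank T (N.IRes W' C') ≤
        ((C.card : ℝ) - W.card) / rowRank T (N.I C) := by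
  obtain ⟨W', hW', hmin⟩ := N.exists_mem_wiretapHat hW
  have hI : N.I C ⊆ N.IRes W' (C \ W) := N.I_subset_of_isCutFromSources hmin.1
  have hD' : N.D W' ⊆ N.IRes W' (C \ W) :=
    (N.D_eq_of_mem_MINCUTFromSources hmin).le.trans (hD.trans hI)
  obtain ⟨C', hC', hmin'⟩ := N.exists_mem_cutHat (Finset.Nonempty.mono hI hC) hD'
  refine ⟨W', hW', C', hC', ?_⟩
  have hI' := hI.trans (N.IRes_subset_of_isCutToSink hmin'.1)
  -- `C \ W` may meet `W'`; this is harmless because minimality of `C'` holds against all separating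
  -- sets, not only those disjoint from `W'`.
  have hcard : C'.card ≤ (C \ W).card :=
    (N.mem_MINCUTToSink_iff.1 hmin').2 _ .self
  have hcard' : (C.card : ℝ) - W.card = (C \ W).card := by
    rw [Finset.cast_card_sdiff hWC]
  rw [hcard']
  exact div_le_div₀ (Nat.cast_nonneg _) (Nat.cast_le.2 hcard)
    (Nat.cast_pos.2 (rowRank_pos hT hC)) (Nat.cast_le.2 (rowRank_mono T hI'))

theorem le_of_mem_rateRegion [Finite F] {N : Network V E s} {T : Matrix (Fin s) (Fin k) F}
    (hT : ∀ i, T i ≠ 0) {r : ℕ} {W C : Finset E} (hW : W.card ≤ r) (hC : C ∈ N.cutSets)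
    (hWC : W ⊆ C) (hD : N.D W ⊆ N.I C) {R : ℝ} (hR : R ∈ N.rateRegion F (linearTarget T) id r) :
    R ≤ ((C.card : ℝ) - W.card) / rowRank T (N.I C) := by
  refine le_of_forall_pos_le_add fun ε hε => ?_
  obtain ⟨ℓ, n, c, -, hn, hcomp, hsec, hlt⟩ := hR.2 ε hε
  have h := Code.mul_rowRank_le hcomp hsec hW hD
  have h' : (ℓ : ℝ) / n ≤ ((C.card : ℝ) - W.card) / rowRank T (N.I C) := by
    rw [div_le_div_iff₀ (Nat.cast_pos.2 hn) (Nat.cast_pos.2 (rowRank_pos hT hC)),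
      ← Finset.cast_card_sdiff hWC, mul_comm _ (n : ℝ)]
    exact_mod_cast h
  linarith

/-- Achievability allows an arbitrary loss `ε`, so it passes to the supremum: half of `ε`
approximates the supremum, the other half is left to the code. -/
theorem isGreatest_secureCapacity {A B O Q : Type*} {N : Network V E s} {f : (Fin s → A) → O}
    {ζ : (Fin s → A) → Q} {r : ℕ} (hne : (N.rateRegion B f ζ r).Nonempty)
    (hbdd : BddAbove (N.rateRegion B f ζ r)) :
    IsGreatest (N.rateRegion B f ζ r) (N.secureCapacity B f ζ r) := by
  refine ⟨⟨?_, fun ε hε => ?_⟩, fun R hR => le_csSup hbdd hR⟩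
  · obtain ⟨R, hR⟩ := hne
    exact hR.1.trans (le_csSup hbdd hR)
  · obtain ⟨R, hR, hlt⟩ := exists_lt_of_lt_csSup hne
      (sub_lt_self (N.secureCapacity B f ζ r) (half_pos hε))
    obtain ⟨ℓ, n, c, hℓ, hn, hcomp, hsec, h⟩ := hR.2 (ε / 2) (half_pos hε)
    exact ⟨ℓ, n, c, hℓ, hn, hcomp, hsec, by linarith⟩

end Network

theorem exists_isLeast_image {α : Type*} [Finite α] {S : Set α} (hS : S.Nonempty) (f : α → ℝ) :
    ∃ x, IsLeast (f '' S) x := by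
  obtain ⟨a, ha, h⟩ := Set.exists_min_image S f (Set.toFinite S) hS
  exact ⟨f a, ⟨a, ha, rfl⟩, Set.forall_mem_image.2 h⟩

theorem mainTheorem4 {V E F : Type*} [Finite V] [Finite E] [Field F] [Finite F]
    {s k : ℕ} (hs : 0 < s) (N : Network V E s) (T : Matrix (Fin s) (Fin k) F)
    (hT : ∀ i, T i ≠ 0) (r : ℕ) :
    -- each class has exactly one bottom, respectively top, element
    (∀ Cl ∈ N.sourceClasses r, ∃! b, N.IsBottomOf Cl b) ∧
    (∀ W ∈ N.wiretapHat r, ∀ Cl ∈ N.sinkClasses W, ∃! t, N.IsTopOf W Cl t) ∧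
    -- the capacity is the maximum of the rate region
    ((N.rateRegion F (linearTarget T) id r).Nonempty →
      IsGreatest (N.rateRegion F (linearTarget T) id r)
        (N.secureCapacity F (linearTarget T) id r)) ∧
    ∃ (Ω : Finset E → ℝ) (b : ℝ),
      -- `b` is the minimum over `W` of the minima `Ω W` over `C`
      (∀ W ∈ N.wiretapHat r,
        IsLeast ((fun C : Finset E => (C.card : ℝ) / rowRank T (N.IRes W C)) '' N.cutHat W)
          (Ω W)) ∧
      IsLeast (Ω '' N.wiretapHat r) b ∧
      -- `b` is the upper bound given by all pairs `(W, C)`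
      IsLeast {x : ℝ | ∃ W C : Finset E, W.card ≤ r ∧ C ∈ N.cutSets ∧ W ⊆ C ∧ N.D W ⊆ N.I C ∧
        x = ((C.card : ℝ) - W.card) / rowRank T (N.I C)} b ∧
      N.secureCapacity F (linearTarget T) id r ≤ b := by
  choose Ω hΩ using fun W : Finset E => exists_isLeast_image (N.cutHat_nonempty hs W)
    (fun C : Finset E => (C.card : ℝ) / rowRank T (N.IRes W C))
  obtain ⟨W₀, hW₀, -⟩ := N.exists_mem_wiretapHat (r := r) (W := ∅) (Nat.zero_le r)
  obtain ⟨b, hb⟩ := exists_isLeast_image ⟨W₀, hW₀⟩ Ω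
  have hpairs : IsLeast {x : ℝ | ∃ W C : Finset E, W.card ≤ r ∧ C ∈ N.cutSets ∧ W ⊆ C ∧
      N.D W ⊆ N.I C ∧ x = ((C.card : ℝ) - W.card) / rowRank T (N.I C)} b := by
    constructor
    · obtain ⟨W, hW, rfl⟩ := hb.1
      obtain ⟨C, hC, hΩC⟩ := (hΩ W).1
      obtain ⟨⟨hdisj, hI⟩, -, hD⟩ := N.cutHat_subset W hC
      -- `I (W ∪ C)` is `IRes W C` by definition, and disjointness turns `|W ∪ C| - |W|` into `|C|`.
      refine ⟨W, W ∪ C, (N.wiretapHat_subset r hW).2, hI, Finset.subset_union_left, hD, ?_⟩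
      rw [Finset.card_union_of_disjoint hdisj.symm, Nat.cast_add, add_sub_cancel_left]
      exact hΩC.symm
    · rintro _ ⟨W, C, hW, hC, hWC, hD, rfl⟩
      obtain ⟨W', hW', C', hC', hle⟩ := N.exists_bottom_top_ratio_le T hT hW hC hWC hD
      exact (hb.2 ⟨W', hW', rfl⟩).trans (((hΩ W').2 ⟨C', hC', rfl⟩).trans hle)
  obtain ⟨W, C, hW, hC, hWC, hD, rfl⟩ := hpairs.1
  have hub : ∀ R ∈ N.rateRegion F (linearTarget T) id r,
      R ≤ ((C.card : ℝ) - W.card) / rowRank T (N.I C) := fun R hR =>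
    Network.le_of_mem_rateRegion hT hW hC hWC hD hR
  refine ⟨fun Cl hCl => N.existsUnique_isBottomOf hCl,
    fun W _ Cl hCl => N.existsUnique_isTopOf hCl,
    fun hne => Network.isGreatest_secureCapacity hne ⟨_, hub⟩,
    Ω, _, fun W _ => hΩ W, hb, hpairs, Real.sSup_le hub ?_⟩
  -- Nonnegativity covers an empty rate region, whose `sSup` is `0`.
  exact div_nonneg (sub_nonneg.2 (Nat.cast_le.2 (Finset.card_le_card hWC))) (Nat.cast_nonneg _)
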